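/- Let $K$ be a field of characteristic zero, let $n\ge 2$ and let $K[x]=K[x_1,\ldots,x_n]$. For $f\in K[x]$ write $f_{x_j}=\partial f/\partial x_j$. Let $H=(H_1,\ldots,H_n)$ with all $H_i\in K[x]$ be a polynomial map of the form $$ H=\bigl(H_1(x_1,\ldots,x_n),\;H_2(x_1,x_2),\;h_3(x_1,x_2,H_1),\;\ldots,\;h_n(x_1,x_2,H_1)\bigr), $$ that is, $H_1\in K[x]$ is arbitrary, $H_2\in K[x_1,x_2]$, and $H_i=h_i(x_1,x_2,H_1)$ with $h_i\in K[x_1,x_2,x_3]$ for $3\le i\le n$. Assume that the Jacobian matrix $JH=\bigl((H_i)_{x_j}\bigr)_{1\le i,j\le n}$ is nilpotent. Then $$ (H_1)_{x_1}+(H_2)_{x_2}=0 $$ holds in each of the following two cases. (i) $H_2\in K$, and $h_i$ lies in the ideal $(x_1,x_3^2)$ of $K[x_1,x_2,x_3]$ for every $3\le i\le n$. (ii) $H_2\notin K$, and $h_i$ lies in the ideal $(x_1,x_2,x_3^2)$ of $K[x_1,x_2,x_3]$ for every $3\le i\le n$. -/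

import Mathlib

/-- The Jacobian matrix `JH = (∂Hᵢ/∂xⱼ)` of a polynomial map `H = (H₁, …, Hₙ)`. -/
noncomputable def polyJacobian {K : Type*} [CommSemiring K] {n : ℕ}
    (H : Fin n → MvPolynomial (Fin n) K) : Matrix (Fin n) (Fin n) (MvPolynomial (Fin n) K) :=
  Matrix.of fun i j => MvPolynomial.pderiv j (H i)

/-- `H` has the form
`(H₁(x₁,…,xₙ), H₂(x₁,x₂), h₃(x₁,x₂,H₁), …, hₙ(x₁,x₂,H₁))` with `n = m + 2`.
Indices start at `0`: the variable `xⱼ` is `X (j - 1)`, the component `Hⱼ` is `H (j - 1)`, and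
`h i` is the polynomial `hᵢ₊₃ ∈ K[x₁,x₂,x₃]`, which determines the component
`Hᵢ₊₃ = H i.succ.succ`. -/
structure HasGeneralizedForm {K : Type*} [Field K] {m : ℕ}
    (H : Fin (m + 2) → MvPolynomial (Fin (m + 2)) K)
    (h : Fin m → MvPolynomial (Fin 3) K) : Prop where
  second_mem : H 1 ∈ Algebra.adjoin K {MvPolynomial.X 0, MvPolynomial.X 1}
  rest_eq : ∀ i : Fin m,
    H i.succ.succ = MvPolynomial.aeval ![MvPolynomial.X 0, MvPolynomial.X 1, H 0] (h i)

/-! Write F = H₁, g = H₂ and L(w) = ∑ ∂F/∂xᵢ · wᵢ(x₁,x₂,F), summed over i ≥ 3; ∂₁, ∂₂, ∂₃ act on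
tuples w over K[x₁,x₂,x₃], and gₖ = ∂g/∂xₖ. Since JH factors through the Jacobian of (x₁,x₂,F), its
nilpotency passes to a 3×3 matrix, whose trace, principal minors and determinant give three
identities. The trace reads ∂F/∂x₁ + g₂ = -L(∂₃h), so the claim is L(∂₃h) = 0.

The main tool is that a locally nilpotent derivation of a domain of characteristic zero has no
nonzero eigenvalue. For vector fields whose coefficients depend on x₃,…,xₙ only through F, the
∂F/∂xⱼ (j ≥ 3) become eigenvectors, so the eigenvalue, itself a combination of them, vanishes. This
makes ker L stable under ∂₃ and ∂₁, and under ∂₂ if g₁ ≠ 0; it also gives L(∂₃∂₃h) = 0. A tuple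
whose derivative in one of these variables lies in ker L is congruent modulo ker L to its value with
that variable set to zero. Hence, once L(∂₁∂₃h) = 0 (and L(∂₂∂₃h) = 0 in case (ii)), ∂₃h can be
replaced by its value at x₁ = x₃ = 0 (at the origin), which is zero by the ideal hypothesis.

In case (i) L(∂₁h) = 0 is immediate. In case (ii) g₁ ≠ 0, and π = L(∂₁∂₃h) is the eigenvalue of a
lift δ of the Jacobian derivation of g. If the level curves of g are lines, δ is locally nilpotent
and π = 0. Otherwise a curvature identity puts π in K[x₁,x₂], and a Riccati equation for π produces,
were π ≠ 0, a nonzero polynomial l(x₂,…) with (1/l)'' = 0 but l' ≠ 0, which is impossible. -/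

namespace Derivation

/-! ### Locally nilpotent derivations -/

section CommRing

variable {K A : Type*} [CommRing K] [CommRing A] [Algebra K A] (D : Derivation K A A)

theorem map_mul_ring (a b : A) : D (a * b) = a * D b + b * D a := by
  simp

theorem iterate_mul_of_const {a : A} (ha : D a = 0) (n : ℕ) (b : A) :
    D^[n] (a * b) = a * D^[n] b := by
  induction n generalizing b with
  | zero => rfl
  | succ n ih => rw [Function.iterate_succ_apply, map_mul_ring, ha, mul_zero, add_zero, ih,
      ← Function.iterate_succ_apply]

theorem iterate_eq_zero_of_le {a : A} {m n : ℕ} (h : D^[m] a = 0) (hmn : m ≤ n) :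
    D^[n] a = 0 := by
  obtain ⟨k, rfl⟩ := Nat.exists_eq_add_of_le' hmn
  rw [Function.iterate_add_apply, h, iterate_map_zero]

theorem iterate_mul_eq_zero {m n : ℕ} {a b : A} (ha : D^[m] a = 0) (hb : D^[n] b = 0) :
    D^[m + n] (a * b) = 0 := by
  induction h : m + n generalizing m n a b with
  | zero =>
    obtain ⟨rfl, rfl⟩ : m = 0 ∧ n = 0 := by omega
    simp_all
  | succ s ih =>
    have key : ∀ {p q : ℕ} {c d : A}, D^[p] c = 0 → D^[q] d = 0 → p + q = s + 1 →
        D^[s] (c * D d) = 0 := by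
      intro p q c d hc hd hpq
      cases q with
      | zero =>
        have : d = 0 := hd
        simp [this, iterate_map_zero]
      | succ q => exact ih hc (by rwa [← Function.iterate_succ_apply]) (by omega)
    rw [Function.iterate_succ_apply, map_mul_ring, iterate_map_add, key ha hb h,
      key hb ha (by omega), add_zero]

/-- The elements annihilated by some power of a derivation. -/
def nilSubalgebra : Subalgebra K A where
  carrier := {a | ∃ n, D^[n] a = 0}
  mul_mem' := by
    rintro a b ⟨m, hm⟩ ⟨n, hn⟩
    exact ⟨m + n, D.iterate_mul_eq_zero hm hn⟩
  add_mem' := by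
    rintro a b ⟨m, hm⟩ ⟨n, hn⟩
    refine ⟨m + n, ?_⟩
    rw [iterate_map_add, D.iterate_eq_zero_of_le hm (by omega),
      D.iterate_eq_zero_of_le hn (by omega), add_zero]
  algebraMap_mem' r := ⟨1, by simp⟩

theorem mem_nilSubalgebra {a : A} : a ∈ D.nilSubalgebra ↔ ∃ n, D^[n] a = 0 := Iff.rfl

theorem mem_nilSubalgebra_of_map {a : A} (h : D a ∈ D.nilSubalgebra) : a ∈ D.nilSubalgebra := by
  obtain ⟨n, hn⟩ := h
  exact ⟨n + 1, hn⟩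

theorem mem_nilSubalgebra_of_map_eq_zero {a : A} (h : D a = 0) : a ∈ D.nilSubalgebra :=
  ⟨1, h⟩

/-- In the Leibniz expansion every other term differentiates `a` more than m times or `b` more than
n times. -/
theorem iterate_mul_top {m n : ℕ} {a b : A} (ha : D^[m + 1] a = 0) (hb : D^[n + 1] b = 0) :
    D^[m + n] (a * b) = (m + n).choose m * (D^[m] a * D^[n] b) := by
  induction h : m + n generalizing m n a b with
  | zero =>
    obtain ⟨rfl, rfl⟩ : m = 0 ∧ n = 0 := by omega
    simp
  | succ s ih =>
    rcases m with _ | m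
    · obtain rfl : n = s + 1 := by omega
      rw [iterate_mul_of_const D ha]
      simp
    rcases n with _ | n
    · obtain rfl : m = s := by omega
      rw [mul_comm a b, iterate_mul_of_const D hb]
      simp [mul_comm]
    rw [Function.iterate_succ_apply, map_mul_ring, iterate_map_add,
      ih (m := m + 1) (n := n) ha (by rwa [← Function.iterate_succ_apply]) (by omega),
      ih (m := n + 1) (n := m) hb (by rwa [← Function.iterate_succ_apply]) (by omega),
      ← Function.iterate_succ_apply, ← Function.iterate_succ_apply,
      Nat.choose_symm_of_eq_add (show s = (n + 1) + m by omega), Nat.choose_succ_succ]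
    push_cast
    ring

theorem exists_iterate_ne_zero {a : A} (ha : a ≠ 0) (h : a ∈ D.nilSubalgebra) :
    ∃ n, D^[n] a ≠ 0 ∧ D^[n + 1] a = 0 := by
  classical
  obtain ⟨n, hn⟩ := h
  induction n with
  | zero => exact absurd hn ha
  | succ n ih =>
    by_cases h : D^[n] a = 0
    · exact ih h
    · exact ⟨n, h, hn⟩

end CommRing

section Domain

variable {K A : Type*} [CommRing K] [CommRing A] [Algebra K A] [IsDomain A] [CharZero A]
  (D : Derivation K A A)

/-- A locally nilpotent derivation has no nonzero eigenvalue. -/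
theorem mul_eq_zero_of_map_eq_mul (hD : ∀ a, a ∈ D.nilSubalgebra) {c f : A} (h : D f = c * f) :
    c * f = 0 := by
  by_contra hcf
  obtain ⟨hc, hf⟩ := mul_ne_zero_iff.mp hcf
  obtain ⟨m, hm, hm'⟩ := D.exists_iterate_ne_zero hc (hD c)
  obtain ⟨n, hn, hn'⟩ := D.exists_iterate_ne_zero hf (hD f)
  have h1 := D.iterate_mul_top hm' hn'
  -- As c f = D f, the left side is the (m+n+1)-st iterate on f, beyond the order of f; the right
  -- side is a product of nonzero factors.
  rw [← h, ← Function.iterate_succ_apply, D.iterate_eq_zero_of_le hn' (by omega)] at h1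
  have : ((m + n).choose m : A) ≠ 0 := Nat.cast_ne_zero.mpr (Nat.choose_pos (by omega)).ne'
  exact mul_ne_zero this (mul_ne_zero hm hn) h1.symm

/-- For a locally nilpotent derivation, the equation `(1/f)'' = 0` only has constant solutions. -/
theorem map_eq_zero_of_mul_map_map (hD : ∀ a, a ∈ D.nilSubalgebra) {f : A}
    (h : f * D (D f) = 2 * D f ^ 2) : D f = 0 := by
  -- Model: the successive derivatives of f = 1/(at + b). For large k the left side vanishes,
  -- forcing D f = 0.
  have key : ∀ k : ℕ, f ^ k * D^[k] (D f) = (k + 1).factorial * D f ^ (k + 1) := by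
    intro k
    induction k with
    | zero => simp
    | succ k ih =>
      have h1 : D (f ^ k * D^[k] (D f)) = D ((k + 1).factorial * D f ^ (k + 1)) := by rw [ih]
      rw [map_mul_ring, map_mul_ring, leibniz_pow, leibniz_pow, map_natCast,
        ← Function.iterate_succ_apply' D k (D f)] at h1
      have h2 : f * (k • f ^ (k - 1) • D f) = k * f ^ k * D f := by
        rcases k with _ | k
        · simp
        · simp only [add_tsub_cancel_right, smul_eq_mul, nsmul_eq_mul]
          ring
      simp only [smul_eq_mul, nsmul_eq_mul, add_tsub_cancel_right] at h1 h2
      rw [Nat.factorial_succ (k + 1)]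
      push_cast at *
      linear_combination f * h1 - D^[k] (D f) * h2 - k * D f * ih
        + ((k + 1).factorial : A) * (k + 1) * D f ^ k * h
  obtain ⟨n, hn⟩ := hD (D f)
  have h3 := key n
  rw [hn, mul_zero] at h3
  rcases mul_eq_zero.mp h3.symm with h4 | h4
  · exact absurd h4 (Nat.cast_ne_zero.mpr (Nat.factorial_ne_zero _))
  · exact pow_eq_zero_iff (by omega) |>.mp h4

end Domain

end Derivation

open MvPolynomial

/-! ### Partial derivatives and setting a variable to zero -/

namespace MvPolynomial

section CommRing

variable {σ K : Type*} [CommRing K]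

theorem forall_mem_nilSubalgebra (D : Derivation K (MvPolynomial σ K) (MvPolynomial σ K))
    (h : ∀ i, X i ∈ D.nilSubalgebra) (f : MvPolynomial σ K) : f ∈ D.nilSubalgebra := by
  have : (⊤ : Subalgebra K (MvPolynomial σ K)) ≤ D.nilSubalgebra := by
    rw [← adjoin_range_X]
    exact Algebra.adjoin_le (by rintro _ ⟨i, rfl⟩; exact h i)
  exact this trivial

theorem mem_nilSubalgebra_pderiv (i : σ) (f : MvPolynomial σ K) :
    f ∈ (pderiv (R := K) i).nilSubalgebra := by
  classical
  refine forall_mem_nilSubalgebra _ (fun j => ⟨2, ?_⟩) f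
  by_cases hij : i = j
  · subst hij
    simp [Function.iterate_succ_apply]
  · simp [Function.iterate_succ_apply, pderiv_X_of_ne (Ne.symm hij)]

theorem pderiv_pderiv_comm (i j : σ) (f : MvPolynomial σ K) :
    pderiv i (pderiv j f) = pderiv j (pderiv i f) := by
  classical
  ext s
  simp only [coeff_pderiv, add_right_comm s (Finsupp.single i 1)]
  by_cases hij : i = j
  · subst hij; rfl
  · simp [hij, Ne.symm hij]
    ring

theorem pderiv_iterate_comm (i j : σ) (n : ℕ) (f : MvPolynomial σ K) :
    (pderiv i)^[n] (pderiv j f) = pderiv j ((pderiv i)^[n] f) :=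
  Function.Commute.iterate_left (f := pderiv i) (g := pderiv j) (pderiv_pderiv_comm i j) n f

/-- The chain rule for a derivation and a polynomial substitution. -/
theorem derivation_aeval {τ A : Type*} [Fintype τ] [CommRing A] [Algebra K A]
    (D : Derivation K A A) (v : τ → A) (p : MvPolynomial τ K) :
    D (aeval v p) = ∑ k, aeval v (pderiv k p) * D (v k) := by
  classical
  induction p using MvPolynomial.induction_on with
  | C a => simp
  | add p q hp hq => simp [hp, hq, add_mul, Finset.sum_add_distrib]
  | mul_X p k hp =>
    have h1 : ∀ x, aeval v (pderiv x (p * X k)) * D (v x) =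
        v k * (aeval v (pderiv x p) * D (v x)) + if k = x then aeval v p * D (v x) else 0 := by
      intro x
      rw [(pderiv x).map_mul_ring, pderiv_X, Pi.single_apply]
      split_ifs <;> simp <;> ring
    simp only [h1, Finset.sum_add_distrib, ← Finset.mul_sum, ← hp, Finset.sum_ite_eq,
      Finset.mem_univ, if_true, map_mul, aeval_X, D.map_mul_ring]
    ring

/-- Setting the variable `X i` to zero. -/
noncomputable def substZero [DecidableEq σ] (i : σ) : MvPolynomial σ K →ₐ[K] MvPolynomial σ K :=
  aeval (Function.update X i 0)

theorem substZero_X_self [DecidableEq σ] (i : σ) :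
    substZero i (X i : MvPolynomial σ K) = 0 := by
  simp [substZero]

theorem substZero_X_of_ne [DecidableEq σ] {i j : σ} (h : j ≠ i) :
    substZero i (X j : MvPolynomial σ K) = X j := by
  simp [substZero, h]

theorem pderiv_iterate_X_mul (i : σ) (f : MvPolynomial σ K) (d : ℕ) :
    (pderiv i)^[d + 1] (X i * f) =
      X i * (pderiv i)^[d + 1] f + (d + 1 : MvPolynomial σ K) * (pderiv i)^[d] f := by
  induction d with
  | zero => simp
  | succ d ih =>
    rw [Function.iterate_succ_apply', ih, map_add, (pderiv i).map_mul_ring,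
      (pderiv i).map_mul_ring, ← Function.iterate_succ_apply' (pderiv i) (d + 1),
      ← Function.iterate_succ_apply' (pderiv i) d, pderiv_X_self]
    simp only [map_add, Derivation.map_natCast, Derivation.map_one_eq_zero]
    push_cast
    ring

end CommRing

section CharZero

variable {σ K : Type*} [CommRing K] [IsDomain K] [CharZero K]

theorem apply_eq_zero_of_pderiv_eq_zero {i : σ} {f : MvPolynomial σ K} (h : pderiv i f = 0)
    {s : σ →₀ ℕ} (hs : s ∈ f.support) : s i = 0 := by
  classical
  by_contra hsi
  have h1 := coeff_pderiv (i := i) f (s - Finsupp.single i 1)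
  rw [tsub_add_cancel_of_le (by simpa [Finsupp.single_le_iff] using Nat.one_le_iff_ne_zero.mpr hsi),
    h, coeff_zero] at h1
  rcases mul_eq_zero.mp h1.symm with h2 | h2
  · exact mem_support_iff.mp hs h2
  · exact Nat.cast_add_one_ne_zero _ h2

theorem exists_eq_C_of_pderiv_eq_zero {f : MvPolynomial σ K} (h : ∀ i, pderiv i f = 0) :
    ∃ c, f = C c := by
  classical
  refine ⟨coeff 0 f, ?_⟩
  ext s
  rw [coeff_C]
  split_ifs with hs
  · rw [hs]
  · by_contra hne
    refine hs (Eq.symm ?_)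
    ext i
    exact apply_eq_zero_of_pderiv_eq_zero (h i) (mem_support_iff.mpr hne)

theorem substZero_eq_self_of_pderiv_eq_zero [DecidableEq σ] {i : σ} {f : MvPolynomial σ K}
    (h : pderiv i f = 0) : substZero i f = f := by
  have h1 : substZero i f = aeval X f := by
    refine eval₂Hom_congr' rfl (fun j hj _ => ?_) rfl
    have : j ≠ i := by
      rintro rfl
      obtain ⟨s, hs, hj⟩ := (mem_vars_iff_mem_support _).mp hj
      exact Finsupp.mem_support_iff.mp hj (apply_eq_zero_of_pderiv_eq_zero h hs)
    simp [this]
  simpa using h1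

end CharZero

section Field

variable {σ K ι : Type*} [Field K] [CharZero K] [DecidableEq σ]

/-- If a submodule of tuples is stable under `∂ᵢ`, then a tuple whose `∂ᵢ`-derivative belongs to it
agrees modulo the submodule with its value at `X i = 0`. -/
theorem sub_substZero_mem [Finite ι] (N : Submodule (MvPolynomial σ K) (ι → MvPolynomial σ K))
    (i : σ) (hN : ∀ w ∈ N, (fun k => pderiv i (w k)) ∈ N) (w : ι → MvPolynomial σ K)
    (hw : (fun k => pderiv i (w k)) ∈ N) :
    (fun k => w k - substZero i (w k)) ∈ N := by
  have key : ∀ d : ℕ, ∀ w : ι → MvPolynomial σ K, (∀ k, (pderiv i)^[d + 1] (w k) = 0) →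
      (fun k => pderiv i (w k)) ∈ N → (fun k => w k - substZero i (w k)) ∈ N := by
    intro d
    induction d with
    | zero =>
      intro w hd _
      have : (fun k => w k - substZero i (w k)) = 0 := by
        ext1 k
        simp [substZero_eq_self_of_pderiv_eq_zero (hd k)]
      rw [this]
      exact N.zero_mem
    | succ d ih =>
      intro w hd hw
      have h0 : (C ((d : K) + 1)⁻¹ : MvPolynomial σ K) * (d + 1) = 1 := by
        have : ((d : MvPolynomial σ K) + 1) = C ((d : K) + 1) := by simp
        rw [this, ← C_mul, inv_mul_cancel₀ (Nat.cast_add_one_ne_zero d), C_1]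
      -- The Euler-type combination cancels the terms of degree d + 1 in X i, and its value at X i =
      -- 0 is (d + 1) times that of w.
      have h1 := ih (fun k => (d + 1 : MvPolynomial σ K) * w k - X i * pderiv i (w k)) (fun k => by
        have h2 : ∀ f : MvPolynomial σ K, (pderiv i)^[d + 1] ((d + 1 : MvPolynomial σ K) * f) =
            (d + 1 : MvPolynomial σ K) * (pderiv i)^[d + 1] f := fun f =>
          (pderiv i).iterate_mul_of_const (by simp) _ _
        rw [iterate_map_sub, h2, pderiv_iterate_X_mul, ← Function.iterate_succ_apply,
          ← Function.iterate_succ_apply, hd k]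
        ring) (by
        have h3 := N.sub_mem (N.smul_mem (d : MvPolynomial σ K) hw)
          (N.smul_mem (X i) (hN _ hw))
        convert h3 using 1
        ext1 k
        simp only [map_sub, (pderiv i).map_mul_ring, map_add, Derivation.map_natCast,
          Derivation.map_one_eq_zero, pderiv_X_self, Pi.sub_apply, Pi.smul_apply, smul_eq_mul]
        ring)
      have h4 := N.smul_mem (C ((d : K) + 1)⁻¹) (N.add_mem h1 (N.smul_mem (X i) hw))
      convert h4 using 1
      ext1 k
      simp only [map_sub, map_mul, substZero_X_self, map_add, map_natCast, map_one, Pi.add_apply,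
        Pi.smul_apply, smul_eq_mul]
      linear_combination (substZero i (w k) - w k) * h0
  choose n hn using fun k => mem_nilSubalgebra_pderiv i (w k)
  obtain ⟨M, hM⟩ := (Set.finite_range n).bddAbove
  refine key M w (fun k => (pderiv i).iterate_eq_zero_of_le (hn k) ?_) hw
  exact (hM ⟨k, rfl⟩).trans (Nat.le_succ M)

end Field

end MvPolynomial

/-! ### The pairing and vertical vector fields -/

namespace GeneralizedForm

section Basic

variable {K : Type*} [Field K] {m : ℕ}

/-- The substitution `p ↦ p(x₁, x₂, F)`. -/
noncomputable abbrev evalAt (F : MvPolynomial (Fin (m + 2)) K) :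
    MvPolynomial (Fin 3) K →ₐ[K] MvPolynomial (Fin (m + 2)) K :=
  aeval ![X 0, X 1, F]

/-- The derivative of a tuple with respect to one of the variables `x₁, x₂, x₃`. -/
noncomputable abbrev tupleDeriv (k : Fin 3) (w : Fin m → MvPolynomial (Fin 3) K) :
    Fin m → MvPolynomial (Fin 3) K :=
  fun i => pderiv k (w i)

/-- The pairing `∑ᵢ ∂F/∂xᵢ · wᵢ(x₁, x₂, F)` over the variables `x₃, …, xₙ`. -/
noncomputable def pairing (F : MvPolynomial (Fin (m + 2)) K)
    (w : Fin m → MvPolynomial (Fin 3) K) : MvPolynomial (Fin (m + 2)) K :=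
  ∑ i : Fin m, pderiv i.succ.succ F * evalAt F (w i)

/-- The kernel of `pairing F`. -/
noncomputable def pairingKer (F : MvPolynomial (Fin (m + 2)) K) :
    Submodule (MvPolynomial (Fin 3) K) (Fin m → MvPolynomial (Fin 3) K) where
  carrier := {w | pairing F w = 0}
  add_mem' := by
    intro v w hv hw
    have : pairing F (v + w) = pairing F v + pairing F w := by
      simp [pairing, mul_add, Finset.sum_add_distrib]
    rw [Set.mem_ofPred_eq] at *
    rw [this, hv, hw, add_zero]
  zero_mem' := by simp [pairing]
  smul_mem' := by
    intro c w hw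
    have : pairing F (c • w) = evalAt F c * pairing F w := by
      simp only [pairing, Pi.smul_apply, smul_eq_mul, map_mul, Finset.mul_sum]
      exact Finset.sum_congr rfl fun i _ => by ring
    rw [Set.mem_ofPred_eq] at *
    rw [this, hw, mul_zero]

theorem mem_pairingKer {F : MvPolynomial (Fin (m + 2)) K} {w : Fin m → MvPolynomial (Fin 3) K} :
    w ∈ pairingKer F ↔ pairing F w = 0 := Iff.rfl

theorem tupleDeriv_comm (j k : Fin 3) (w : Fin m → MvPolynomial (Fin 3) K) :
    tupleDeriv j (tupleDeriv k w) = tupleDeriv k (tupleDeriv j w) :=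
  funext fun i => pderiv_pderiv_comm j k (w i)

/-- The vector field `a ∂₁ + b ∂₂ + ∑ᵢ cᵢ ∂ᵢ₊₂`. -/
noncomputable def vectorField (a b : MvPolynomial (Fin (m + 2)) K)
    (c : Fin m → MvPolynomial (Fin (m + 2)) K) :
    Derivation K (MvPolynomial (Fin (m + 2)) K) (MvPolynomial (Fin (m + 2)) K) :=
  mkDerivation K (Fin.cons a (Fin.cons b c))

variable (a b : MvPolynomial (Fin (m + 2)) K) (c : Fin m → MvPolynomial (Fin (m + 2)) K)

@[simp]
theorem vectorField_X_zero : vectorField a b c (X 0) = a := by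
  simp [vectorField, mkDerivation_X]

@[simp]
theorem vectorField_X_one : vectorField a b c (X 1) = b := by
  rw [vectorField, mkDerivation_X]
  rfl

@[simp]
theorem vectorField_X_succ_succ (i : Fin m) : vectorField a b c (X i.succ.succ) = c i := by
  simp [vectorField, mkDerivation_X]

theorem vectorField_apply (f : MvPolynomial (Fin (m + 2)) K) :
    vectorField a b c f =
      a * pderiv 0 f + b * pderiv 1 f + ∑ i : Fin m, c i * pderiv i.succ.succ f := by
  have h := derivation_aeval (vectorField a b c) X f
  rw [aeval_X_left_apply, Fin.sum_univ_succ, Fin.sum_univ_succ] at h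
  simp only [aeval_X_left_apply, Fin.succ_zero_eq_one, vectorField_X_zero, vectorField_X_one,
    vectorField_X_succ_succ] at h
  rw [h]
  simp only [mul_comm, ← add_assoc]

theorem vectorField_apply_of_pderiv_eq_zero {f : MvPolynomial (Fin (m + 2)) K}
    (hf : ∀ i : Fin m, pderiv i.succ.succ f = 0) :
    vectorField a b c f = a * pderiv 0 f + b * pderiv 1 f := by
  simp [vectorField_apply, hf]

theorem vectorField_pderiv (j : Fin (m + 2)) (f : MvPolynomial (Fin (m + 2)) K) :
    vectorField a b c (pderiv j f) = pderiv j (vectorField a b c f) -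
      (pderiv j a * pderiv 0 f + pderiv j b * pderiv 1 f +
        ∑ i : Fin m, pderiv j (c i) * pderiv i.succ.succ f) := by
  simp only [vectorField_apply, map_add, map_sum, (pderiv j).map_mul_ring, Finset.sum_add_distrib,
    pderiv_pderiv_comm j, mul_comm (pderiv _ f)]
  ring

theorem forall_mem_nilSubalgebra_vectorField (h0 : a ∈ (vectorField a b c).nilSubalgebra)
    (h1 : b ∈ (vectorField a b c).nilSubalgebra)
    (hc : ∀ i, c i ∈ (vectorField a b c).nilSubalgebra) (f : MvPolynomial (Fin (m + 2)) K) :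
    f ∈ (vectorField a b c).nilSubalgebra := by
  refine forall_mem_nilSubalgebra _ (fun i => ?_) f
  refine Derivation.mem_nilSubalgebra_of_map _ ?_
  refine Fin.cases ?_ (fun i => Fin.cases ?_ (fun i => ?_) i) i
  · simpa using h0
  · simpa using h1
  · simpa using hc i

theorem derivation_evalAt (F : MvPolynomial (Fin (m + 2)) K)
    (D : Derivation K (MvPolynomial (Fin (m + 2)) K) (MvPolynomial (Fin (m + 2)) K))
    (p : MvPolynomial (Fin 3) K) :
    D (evalAt F p) = evalAt F (pderiv 0 p) * D (X 0) + evalAt F (pderiv 1 p) * D (X 1) +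
      evalAt F (pderiv 2 p) * D F := by
  rw [derivation_aeval, Fin.sum_univ_three]
  rfl

theorem one_ne_succ_succ (i : Fin m) : (1 : Fin (m + 2)) ≠ i.succ.succ := by
  rw [← Fin.succ_zero_eq_one]
  exact fun h => Fin.succ_ne_zero _ (Fin.succ_injective _ h).symm

theorem pderiv_succ_succ_evalAt (F : MvPolynomial (Fin (m + 2)) K) (i : Fin m)
    (p : MvPolynomial (Fin 3) K) :
    pderiv i.succ.succ (evalAt F p) = pderiv i.succ.succ F * evalAt F (pderiv 2 p) := by
  rw [derivation_evalAt, pderiv_X_of_ne (Fin.succ_ne_zero _).symm, pderiv_X_of_ne (one_ne_succ_succ i)]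
  ring

theorem evalAt_mem_nilSubalgebra {F : MvPolynomial (Fin (m + 2)) K}
    {D : Derivation K (MvPolynomial (Fin (m + 2)) K) (MvPolynomial (Fin (m + 2)) K)}
    (h0 : X 0 ∈ D.nilSubalgebra) (h1 : X 1 ∈ D.nilSubalgebra) (hF : F ∈ D.nilSubalgebra)
    (p : MvPolynomial (Fin 3) K) : evalAt F p ∈ D.nilSubalgebra := by
  have h : (evalAt F).range ≤ D.nilSubalgebra := by
    rw [← Algebra.adjoin_range_eq_range_aeval]
    refine Algebra.adjoin_le ?_
    rintro _ ⟨k, rfl⟩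
    fin_cases k
    exacts [h0, h1, hF]
  exact h ⟨p, rfl⟩

variable {F : MvPolynomial (Fin (m + 2)) K}

/-- A scalar multiplying every `∂F/∂xᵢ` to zero multiplies the pairing to zero. -/
theorem mul_sum_eq_zero {x : MvPolynomial (Fin (m + 2)) K}
    (h : ∀ i : Fin m, x * pderiv i.succ.succ F = 0) (c : Fin m → MvPolynomial (Fin (m + 2)) K) :
    x * ∑ i : Fin m, pderiv i.succ.succ F * c i = 0 := by
  rw [Finset.mul_sum]
  exact Finset.sum_eq_zero fun i _ => by rw [← mul_assoc, h, zero_mul]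

end Basic

section Vertical

variable {K : Type*} [Field K] [CharZero K] {m : ℕ} {F : MvPolynomial (Fin (m + 2)) K}

/-- A vertical vector field whose coefficients depend on `x₃, …, xₙ` only through `F` and which
annihilates `F` has divergence zero. -/
theorem sum_eq_zero_of_vertical (c c' : Fin m → MvPolynomial (Fin (m + 2)) K)
    (hc : ∀ i j : Fin m, pderiv j.succ.succ (c i) = pderiv j.succ.succ F * c' i)
    (h : ∑ i : Fin m, pderiv i.succ.succ F * c i = 0) :
    ∑ i : Fin m, pderiv i.succ.succ F * c' i = 0 := by
  set D := vectorField 0 0 c with hD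
  have hDF : D F = 0 := by
    simpa [hD, vectorField_apply, mul_comm] using h
  have hDc : ∀ i, D (c i) = 0 := by
    intro i
    rw [hD, vectorField_apply]
    simp only [hc, zero_mul, zero_add, ← mul_assoc, ← Finset.sum_mul]
    rw [Finset.sum_congr rfl fun j _ => mul_comm _ _, h, zero_mul]
  -- D annihilates its own coefficients, so it is locally nilpotent.
  have hnil := forall_mem_nilSubalgebra_vectorField 0 0 c (Subalgebra.zero_mem _)
    (Subalgebra.zero_mem _) fun i => Derivation.mem_nilSubalgebra_of_map_eq_zero _ (hDc i)
  have hDj : ∀ j : Fin m, D (pderiv j.succ.succ F) =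
      -(∑ i : Fin m, pderiv i.succ.succ F * c' i) * pderiv j.succ.succ F := by
    intro j
    rw [hD, vectorField_pderiv, ← hD, hDF]
    simp only [hc, map_zero, zero_mul, zero_add, zero_sub, neg_mul, Finset.sum_mul]
    exact congrArg _ (Finset.sum_congr rfl fun i _ => by ring)
  -- The eigenvalue is minus the divergence, a combination of the eigenvectors; so its square
  -- vanishes.
  have h0 := mul_sum_eq_zero (fun j => D.mul_eq_zero_of_map_eq_mul hnil (hDj j)) c'
  simpa using h0

theorem pairing_tupleDeriv_two {w : Fin m → MvPolynomial (Fin 3) K} (h : pairing F w = 0) :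
    pairing F (tupleDeriv 2 w) = 0 :=
  sum_eq_zero_of_vertical _ _ (fun i j => pderiv_succ_succ_evalAt F j (w i)) h

end Vertical

end GeneralizedForm

/-! ### Lifted derivations and stability of the kernel of the pairing -/

namespace GeneralizedForm

/-- The equations expressing that the Jacobian matrix of
`(F, g(x₁, x₂), h₃(x₁, x₂, F), …, hₙ(x₁, x₂, F))` is nilpotent. -/
structure NilpotencyEquations {K : Type*} [Field K] {m : ℕ} (F g : MvPolynomial (Fin (m + 2)) K)
    (h : Fin m → MvPolynomial (Fin 3) K) : Prop where
  pderiv_snd : ∀ i : Fin m, pderiv i.succ.succ g = 0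
  trace : pderiv 0 F + pairing F (tupleDeriv 2 h) = -pderiv 1 g
  minors : pderiv 0 g * pderiv 1 F + pairing F (tupleDeriv 0 h) = -pderiv 1 g ^ 2
  det : pderiv 0 g * pairing F (tupleDeriv 1 h) = pderiv 1 g * pairing F (tupleDeriv 0 h)

namespace NilpotencyEquations

variable {K : Type*} [Field K] {m : ℕ} {F g : MvPolynomial (Fin (m + 2)) K}
  {h : Fin m → MvPolynomial (Fin 3) K}

/-- The lift of `∂₁` with `F ↦ -∂g/∂x₂`. -/
noncomputable def liftOne (F : MvPolynomial (Fin (m + 2)) K)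
    (h : Fin m → MvPolynomial (Fin 3) K) :
    Derivation K (MvPolynomial (Fin (m + 2)) K) (MvPolynomial (Fin (m + 2)) K) :=
  vectorField 1 0 fun i => evalAt F (pderiv 2 (h i))

/-- The lift of the Jacobian derivation of `g` which annihilates `F`. -/
noncomputable def liftJac (F g : MvPolynomial (Fin (m + 2)) K)
    (h : Fin m → MvPolynomial (Fin 3) K) :
    Derivation K (MvPolynomial (Fin (m + 2)) K) (MvPolynomial (Fin (m + 2)) K) :=
  vectorField (pderiv 1 g) (-pderiv 0 g) fun i =>
    pderiv 1 g * evalAt F (pderiv 2 (h i)) - evalAt F (pderiv 0 (h i))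

theorem pderiv_succ_succ_pderiv {f : MvPolynomial (Fin (m + 2)) K}
    (hf : ∀ i : Fin m, pderiv i.succ.succ f = 0) (k : Fin (m + 2)) (i : Fin m) :
    pderiv i.succ.succ (pderiv k f) = 0 := by
  rw [pderiv_pderiv_comm, hf, map_zero]

theorem derivation_pairing
    (D : Derivation K (MvPolynomial (Fin (m + 2)) K) (MvPolynomial (Fin (m + 2)) K))
    {x : MvPolynomial (Fin (m + 2)) K}
    (hD : ∀ i : Fin m, D (pderiv i.succ.succ F) = x * pderiv i.succ.succ F)
    (w : Fin m → MvPolynomial (Fin 3) K) :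
    D (pairing F w) = D (X 0) * pairing F (tupleDeriv 0 w) + D (X 1) * pairing F (tupleDeriv 1 w) +
      D F * pairing F (tupleDeriv 2 w) + x * pairing F w := by
  simp only [pairing, map_sum, D.map_mul_ring, hD, derivation_evalAt, Finset.mul_sum,
    ← Finset.sum_add_distrib]
  exact Finset.sum_congr rfl fun i _ => by ring

theorem pairing_sub_substZero_two [CharZero K] {w : Fin m → MvPolynomial (Fin 3) K}
    (hw : pairing F (tupleDeriv 2 w) = 0) :
    pairing F (fun i => w i - substZero 2 (w i)) = 0 :=
  sub_substZero_mem (pairingKer F) 2 (fun _ hv => pairing_tupleDeriv_two hv) w hw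

theorem liftOne_of_pderiv_eq_zero {f : MvPolynomial (Fin (m + 2)) K}
    (hf : ∀ i : Fin m, pderiv i.succ.succ f = 0) : liftOne F h f = pderiv 0 f := by
  rw [liftOne, vectorField_apply_of_pderiv_eq_zero _ _ _ hf, one_mul, zero_mul, add_zero]

theorem liftJac_of_pderiv_eq_zero {f : MvPolynomial (Fin (m + 2)) K}
    (hf : ∀ i : Fin m, pderiv i.succ.succ f = 0) :
    liftJac F g h f = pderiv 1 g * pderiv 0 f - pderiv 0 g * pderiv 1 f := by
  rw [liftJac, vectorField_apply_of_pderiv_eq_zero _ _ _ hf, neg_mul, ← sub_eq_add_neg]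

theorem tupleDeriv_two_zero (w : Fin m → MvPolynomial (Fin 3) K) :
    tupleDeriv 2 (tupleDeriv 0 w) = tupleDeriv 0 (tupleDeriv 2 w) := tupleDeriv_comm _ _ _

theorem tupleDeriv_two_one (w : Fin m → MvPolynomial (Fin 3) K) :
    tupleDeriv 2 (tupleDeriv 1 w) = tupleDeriv 1 (tupleDeriv 2 w) := tupleDeriv_comm _ _ _

theorem tupleDeriv_one_zero (w : Fin m → MvPolynomial (Fin 3) K) :
    tupleDeriv 1 (tupleDeriv 0 w) = tupleDeriv 0 (tupleDeriv 1 w) := tupleDeriv_comm _ _ _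

theorem liftOne_iterate (n : ℕ) {f : MvPolynomial (Fin (m + 2)) K}
    (hf : ∀ i : Fin m, pderiv i.succ.succ f = 0) :
    (liftOne F h)^[n] f = (pderiv 0)^[n] f := by
  induction n generalizing f with
  | zero => rw [Function.iterate_zero, Function.iterate_zero]
  | succ n ih =>
    rw [Function.iterate_succ_apply, Function.iterate_succ_apply,
      ← ih (pderiv_succ_succ_pderiv hf 0), liftOne_of_pderiv_eq_zero hf]

variable (H : NilpotencyEquations F g h)
include H

theorem liftOne_fst : liftOne F h F = -pderiv 1 g := by
  rw [liftOne, vectorField_apply, ← H.trace, pairing, one_mul, zero_mul, add_zero]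
  exact congrArg _ (Finset.sum_congr rfl fun i _ => mul_comm _ _)

/-- The lift sends x₁, x₂, F to 1, 0, -g₂ and acts on K[x₁,x₂] as ∂/∂x₁; its remaining coefficients
are polynomials in x₁, x₂, F. -/
theorem liftOne_mem_nilSubalgebra (f : MvPolynomial (Fin (m + 2)) K) :
    f ∈ (liftOne F h).nilSubalgebra := by
  have h1 : liftOne F h (X 1) = 0 := vectorField_X_one _ _ _
  have h0 : liftOne F h (X 0) = 1 := vectorField_X_zero _ _ _
  have hX1 : X 1 ∈ (liftOne F h).nilSubalgebra :=
    Derivation.mem_nilSubalgebra_of_map_eq_zero _ h1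
  have hX0 : X 0 ∈ (liftOne F h).nilSubalgebra := by
    refine Derivation.mem_nilSubalgebra_of_map _ ?_
    rw [h0]
    exact Subalgebra.one_mem _
  have hF : F ∈ (liftOne F h).nilSubalgebra := by
    refine Derivation.mem_nilSubalgebra_of_map _ ?_
    rw [H.liftOne_fst]
    refine neg_mem ?_
    obtain ⟨n, hn⟩ := mem_nilSubalgebra_pderiv 0 (pderiv 1 g)
    refine (Derivation.mem_nilSubalgebra _).mpr ⟨n, ?_⟩
    rw [liftOne_iterate n (pderiv_succ_succ_pderiv H.pderiv_snd 1), hn]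
  have hc : ∀ i, evalAt F (pderiv 2 (h i)) ∈ (liftOne F h).nilSubalgebra :=
    fun i => evalAt_mem_nilSubalgebra hX0 hX1 hF _
  rw [liftOne] at hc ⊢
  exact forall_mem_nilSubalgebra_vectorField _ _ _ (Subalgebra.one_mem _) (Subalgebra.zero_mem _)
    hc f

theorem liftOne_pderiv (j : Fin (m + 2)) :
    liftOne F h (pderiv j F) = -pderiv j (pderiv 1 g) -
      ∑ i : Fin m, pderiv j (evalAt F (pderiv 2 (h i))) * pderiv i.succ.succ F := by
  rw [liftOne, vectorField_pderiv, ← liftOne, H.liftOne_fst]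
  simp

theorem liftOne_pderiv_succ_succ (j : Fin m) :
    liftOne F h (pderiv j.succ.succ F) =
      -pairing F (tupleDeriv 2 (tupleDeriv 2 h)) * pderiv j.succ.succ F := by
  rw [H.liftOne_pderiv, pderiv_succ_succ_pderiv H.pderiv_snd]
  simp only [pderiv_succ_succ_evalAt, pairing, neg_zero, zero_sub, neg_mul, Finset.sum_mul]
  exact congrArg _ (Finset.sum_congr rfl fun i _ => by ring)

theorem liftJac_fst : liftJac F g h F = 0 := by
  have h1 : ∑ i : Fin m, (pderiv 1 g * evalAt F (pderiv 2 (h i)) - evalAt F (pderiv 0 (h i))) *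
      pderiv i.succ.succ F =
      pderiv 1 g * pairing F (tupleDeriv 2 h) - pairing F (tupleDeriv 0 h) := by
    simp only [pairing, Finset.mul_sum, ← Finset.sum_sub_distrib]
    exact Finset.sum_congr rfl fun i _ => by ring
  rw [liftJac, vectorField_apply, h1]
  linear_combination pderiv 1 g * H.trace - H.minors

section CharZero

variable [CharZero K]

theorem pairing_two_two : pairing F (tupleDeriv 2 (tupleDeriv 2 h)) = 0 := by
  have h0 := mul_sum_eq_zero (fun j => (liftOne F h).mul_eq_zero_of_map_eq_mul
    H.liftOne_mem_nilSubalgebra (H.liftOne_pderiv_succ_succ j))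
    (fun i => evalAt F (tupleDeriv 2 (tupleDeriv 2 h) i))
  simpa [pairing] using h0

theorem liftOne_pairing (w : Fin m → MvPolynomial (Fin 3) K) :
    liftOne F h (pairing F w) =
      pairing F (tupleDeriv 0 w) - pderiv 1 g * pairing F (tupleDeriv 2 w) := by
  rw [derivation_pairing (x := 0) _ (fun i => by
    rw [H.liftOne_pderiv_succ_succ, H.pairing_two_two, neg_zero]), H.liftOne_fst]
  simp only [liftOne, vectorField_X_zero, vectorField_X_one]
  ring

/-- Here π appears as an eigenvalue; to conclude π = 0 one still needs local nilpotency of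
`liftJac`, which depends on g. -/
theorem liftJac_pderiv_succ_succ (j : Fin m) :
    liftJac F g h (pderiv j.succ.succ F) =
      pairing F (tupleDeriv 0 (tupleDeriv 2 h)) * pderiv j.succ.succ F := by
  have h1 : ∀ i : Fin m, pderiv j.succ.succ
      (pderiv 1 g * evalAt F (pderiv 2 (h i)) - evalAt F (pderiv 0 (h i))) * pderiv i.succ.succ F =
      pderiv j.succ.succ F * (pderiv 1 g *
        (pderiv i.succ.succ F * evalAt F (tupleDeriv 2 (tupleDeriv 2 h) i)) -
        pderiv i.succ.succ F * evalAt F (tupleDeriv 2 (tupleDeriv 0 h) i)) := by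
    intro i
    rw [map_sub, (pderiv _).map_mul_ring, pderiv_succ_succ_evalAt, pderiv_succ_succ_evalAt,
      pderiv_succ_succ_pderiv H.pderiv_snd]
    ring
  have h2 : pairing F (tupleDeriv 2 (tupleDeriv 2 h)) = 0 := H.pairing_two_two
  rw [liftJac, vectorField_pderiv, ← liftJac, H.liftJac_fst, map_neg,
    pderiv_succ_succ_pderiv H.pderiv_snd, pderiv_succ_succ_pderiv H.pderiv_snd]
  simp only [h1, ← Finset.mul_sum, Finset.sum_sub_distrib]
  rw [← pairing, ← pairing, h2, tupleDeriv_comm]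
  simp
  ring

theorem liftJac_pairing (w : Fin m → MvPolynomial (Fin 3) K) :
    liftJac F g h (pairing F w) =
      pderiv 1 g * pairing F (tupleDeriv 0 w) - pderiv 0 g * pairing F (tupleDeriv 1 w) +
        pairing F (tupleDeriv 0 (tupleDeriv 2 h)) * pairing F w := by
  rw [derivation_pairing _ H.liftJac_pderiv_succ_succ, H.liftJac_fst]
  simp only [liftJac, vectorField_X_zero, vectorField_X_one]
  ring

theorem pairing_tupleDeriv_zero {w : Fin m → MvPolynomial (Fin 3) K} (hw : pairing F w = 0) :
    pairing F (tupleDeriv 0 w) = 0 := by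
  have h1 := H.liftOne_pairing w
  rw [hw, map_zero, pairing_tupleDeriv_two hw] at h1
  linear_combination -h1

/-- The factor is the speed, up to sign, at which `liftJac` moves x₂. -/
theorem mul_pairing_tupleDeriv_one {w : Fin m → MvPolynomial (Fin 3) K} (hw : pairing F w = 0) :
    pderiv 0 g * pairing F (tupleDeriv 1 w) = 0 := by
  have h1 := H.liftJac_pairing w
  rw [hw, map_zero, H.pairing_tupleDeriv_zero hw] at h1
  linear_combination h1

theorem pairing_tupleDeriv_one (hg : pderiv 0 g ≠ 0) {w : Fin m → MvPolynomial (Fin 3) K}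
    (hw : pairing F w = 0) : pairing F (tupleDeriv 1 w) = 0 :=
  (mul_eq_zero.mp (H.mul_pairing_tupleDeriv_one hw)).resolve_left hg

theorem pairing_sub_substZero_zero {w : Fin m → MvPolynomial (Fin 3) K}
    (hw : pairing F (tupleDeriv 0 w) = 0) :
    pairing F (fun i => w i - substZero 0 (w i)) = 0 :=
  sub_substZero_mem (pairingKer F) 0 (fun _ hv => H.pairing_tupleDeriv_zero hv) w hw

theorem pairing_sub_substZero_one (hg : pderiv 0 g ≠ 0) {w : Fin m → MvPolynomial (Fin 3) K}
    (hw : pairing F (tupleDeriv 1 w) = 0) :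
    pairing F (fun i => w i - substZero 1 (w i)) = 0 :=
  sub_substZero_mem (pairingKer F) 1 (fun _ hv => H.pairing_tupleDeriv_one hg hv) w hw

end CharZero

end NilpotencyEquations

end GeneralizedForm

/-! ### Plane polynomials whose level curves are lines -/

namespace MvPolynomial

variable {σ K : Type*} [Field K] [CharZero K]

theorem pderiv_eq_zero_of_dvd {i : σ} {f : MvPolynomial σ K} (h : f ∣ pderiv i f) :
    pderiv i f = 0 := by
  obtain ⟨c, hc⟩ := h
  rw [mul_comm] at hc
  rw [hc, (pderiv i).mul_eq_zero_of_map_eq_mul (mem_nilSubalgebra_pderiv i) hc]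

/-- If `α gⱼ = β gᵢ` with `α` free of `xᵢ`, `β` free of `xⱼ` and `βᵢ = -αⱼ`, then `βᵢ = 0`. -/
theorem pderiv_eq_zero_of_euler {i j : σ} {g α β : MvPolynomial σ K} (hg : pderiv i g ≠ 0)
    (h : α * pderiv j g = β * pderiv i g) (hα : pderiv i α = 0) (hβ : pderiv j β = 0)
    (hαβ : pderiv j α = -pderiv i β) : pderiv i β = 0 := by
  have hei : pderiv i (pderiv i β) = 0 := by
    rw [← neg_eq_zero, ← map_neg, ← hαβ, pderiv_pderiv_comm, hα, map_zero]
  have hej : pderiv j (pderiv i β) = 0 := by rw [pderiv_pderiv_comm, hβ, map_zero]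
  -- Put c = βᵢ. Up to a factorial, γ is the top xᵢ-coefficient of gᵢ; comparing top parts in xᵢ and
  -- then in xⱼ (order k) gives (n + 1)c = -kc on a nonzero polynomial.
  obtain ⟨n, hn, hn'⟩ := (pderiv i).exists_iterate_ne_zero hg (mem_nilSubalgebra_pderiv i _)
  set γ := (pderiv i)^[n] (pderiv i g) with hγ
  have h1 : α * pderiv j γ = (n + 1) * (pderiv i β * γ) := by
    have h2 := (pderiv i).iterate_mul_top (m := 1) hei hn'
    rw [← h, add_comm, (pderiv i).iterate_mul_of_const hα, pderiv_iterate_comm,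
      Function.iterate_succ_apply, ← hγ] at h2
    simpa using h2
  obtain ⟨k, hk, hk'⟩ := (pderiv j).exists_iterate_ne_zero hn (mem_nilSubalgebra_pderiv j _)
  have h3 : (pderiv j)^[k] (α * pderiv j γ) = -(k * (pderiv i β * (pderiv j)^[k] γ)) := by
    rcases k with _ | k
    · have : pderiv j γ = 0 := hk'
      simp [this]
    · have hαj : (pderiv j)^[1 + 1] α = 0 := by
        simp [Function.iterate_succ_apply, hαβ, hej]
      have h4 := (pderiv j).iterate_mul_top (m := 1) (n := k) hαj
        (by rwa [← Function.iterate_succ_apply])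
      rw [add_comm, ← Function.iterate_succ_apply (pderiv j) k γ] at h4
      rw [h4]
      simp [hαβ]
  rw [h1, ← mul_assoc, (pderiv j).iterate_mul_of_const (by
    rw [(pderiv j).map_mul_ring, hej]; simp)] at h3
  have h5 : ((n + 1 + k : ℕ) : MvPolynomial σ K) * (pderiv i β * (pderiv j)^[k] γ) = 0 := by
    push_cast
    linear_combination h3
  have h6 : ((n + 1 + k : ℕ) : MvPolynomial σ K) ≠ 0 := Nat.cast_ne_zero.mpr (by omega)
  exact (mul_eq_zero.mp ((mul_eq_zero.mp h5).resolve_left h6)).resolve_right hk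

/-- A polynomial whose level curves are lines: the Jacobian derivation of `g` annihilates the
partial derivatives of `g`. -/
theorem jacobian_pderiv_eq_zero {i j : σ} {g : MvPolynomial σ K} (hg : pderiv i g ≠ 0)
    (h : pderiv i (pderiv i g) * pderiv j g ^ 2 -
      2 * pderiv j (pderiv i g) * pderiv i g * pderiv j g +
      pderiv j (pderiv j g) * pderiv i g ^ 2 = 0) :
    pderiv j g * pderiv i (pderiv i g) - pderiv i g * pderiv j (pderiv i g) = 0 ∧
      pderiv j g * pderiv i (pderiv j g) - pderiv i g * pderiv j (pderiv j g) = 0 := by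
  obtain ⟨β, α, θ, hrel, hβ, hα⟩ :=
    UniqueFactorizationMonoid.exists_reduced_factors' (pderiv j g) (pderiv i g) hg
  have hcomm := pderiv_pderiv_comm i j g
  have hθ0 : θ ≠ 0 := by rintro rfl; exact hg (by rw [← hα, zero_mul])
  have hα0 : α ≠ 0 := by rintro rfl; exact hg (by rw [← hα, mul_zero])
  -- With gⱼ = θβ and gᵢ = θα in lowest terms, zero curvature says that the slope β/α is constant
  -- along β∂ᵢ - α∂ⱼ.
  have h1 : β * (β * pderiv i α - α * pderiv j α) = α * (β * pderiv i β - α * pderiv j β) := by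
    have h2 : θ ^ 3 * (β * (β * pderiv i α - α * pderiv j α) -
        α * (β * pderiv i β - α * pderiv j β)) = 0 := by
      have h3 : pderiv i (pderiv i g) * pderiv j g ^ 2 -
          (pderiv j (pderiv i g) + pderiv i (pderiv j g)) * pderiv i g * pderiv j g +
          pderiv j (pderiv j g) * pderiv i g ^ 2 = 0 := by
        rw [hcomm]; linear_combination h
      rw [← hα, ← hβ] at h3
      simp only [Derivation.map_mul_ring] at h3
      linear_combination h3
    exact sub_eq_zero.mp ((mul_eq_zero.mp h2).resolve_left (pow_ne_zero 3 hθ0))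
  -- By coprimality α divides its own derivative ∂ᵢα; likewise β divides ∂ⱼβ below.
  have hαi : pderiv i α = 0 := by
    refine pderiv_eq_zero_of_dvd ((hrel.symm.pow_right (n := 2)).dvd_of_dvd_mul_left
      ⟨β * pderiv i β - α * pderiv j β + β * pderiv j α, ?_⟩)
    linear_combination h1
  have hβj : pderiv j β = 0 := by
    refine pderiv_eq_zero_of_dvd ((hrel.pow_right (n := 2)).dvd_of_dvd_mul_left
      ⟨α * pderiv i β - β * pderiv i α + α * pderiv j α, ?_⟩)
    linear_combination h1
  have hA : α * pderiv j g = β * pderiv i g := by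
    rw [← hα, ← hβ]; ring
  by_cases hβ0 : β = 0
  · have hj : pderiv j g = 0 := by rw [← hβ, hβ0, mul_zero]
    rw [← hcomm, hj]
    simp
  have hαβ : pderiv j α = -pderiv i β := by
    have : α * β * (pderiv j α + pderiv i β) = 0 := by
      rw [hαi, hβj] at h1
      linear_combination -h1
    exact eq_neg_of_add_eq_zero_left
      ((mul_eq_zero.mp this).resolve_left (mul_ne_zero hα0 hβ0))
  have hβi := pderiv_eq_zero_of_euler hg hA hαi hβj hαβ
  rw [hβi, neg_zero] at hαβ
  have hAi := congrArg (pderiv i) hA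
  have hAj := congrArg (pderiv j) hA
  simp only [Derivation.map_mul_ring, hαi, hαβ, hβi, hβj, mul_zero, add_zero] at hAi hAj
  rw [hcomm] at hAi ⊢
  constructor
  · refine (mul_eq_zero.mp ?_).resolve_left hα0
    linear_combination pderiv i (pderiv i g) * hA - pderiv i g * hAi
  · refine (mul_eq_zero.mp ?_).resolve_left hα0
    linear_combination pderiv j (pderiv i g) * hA - pderiv i g * hAj

end MvPolynomial

/-! ### The curvature identity -/

namespace GeneralizedForm

namespace NilpotencyEquations

variable {K : Type*} [Field K] [CharZero K] {m : ℕ} {F g : MvPolynomial (Fin (m + 2)) K}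
  {h : Fin m → MvPolynomial (Fin 3) K}

variable (H : NilpotencyEquations F g h)
include H

/-- The curvature numerator of the level curves of `g`, in terms of the pairing. -/
theorem curvature_eq (hb : pderiv 1 g * pairing F (tupleDeriv 0 (tupleDeriv 2 h)) =
      pderiv 0 g * pairing F (tupleDeriv 1 (tupleDeriv 2 h))) :
    pderiv 0 (pderiv 0 g) * pderiv 1 g ^ 2 - 2 * pderiv 1 (pderiv 0 g) * pderiv 0 g * pderiv 1 g +
      pderiv 1 (pderiv 1 g) * pderiv 0 g ^ 2 =
    pderiv 0 g * pairing F (tupleDeriv 0 (tupleDeriv 0 h)) -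
      pderiv 0 (pderiv 0 g) * pairing F (tupleDeriv 0 h) -
      2 * pderiv 0 g * pderiv 1 g * pairing F (tupleDeriv 0 (tupleDeriv 2 h)) := by
  have hg := H.pderiv_snd
  have hFy : liftOne F h (pderiv 1 F) =
      -pderiv 1 (pderiv 1 g) - pairing F (tupleDeriv 1 (tupleDeriv 2 h)) := by
    have h0 : ∑ i : Fin m, pderiv 1 (evalAt F (pderiv 2 (h i))) * pderiv i.succ.succ F =
        pairing F (tupleDeriv 1 (tupleDeriv 2 h)) +
          pderiv 1 F * pairing F (tupleDeriv 2 (tupleDeriv 2 h)) := by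
      simp only [pairing, Finset.mul_sum, ← Finset.sum_add_distrib]
      refine Finset.sum_congr rfl fun i _ => ?_
      rw [derivation_evalAt, pderiv_X_self, pderiv_X_of_ne (by simp)]
      ring
    rw [H.liftOne_pderiv, h0, H.pairing_two_two, mul_zero, add_zero]
  -- The lift of ∂₁ applied to the minors relation brings in the second derivatives of g.
  have h1 := congrArg (liftOne F h) H.minors
  rw [map_add, Derivation.map_mul_ring, map_neg, Derivation.leibniz_pow, H.liftOne_pairing, hFy,
    liftOne_of_pderiv_eq_zero (pderiv_succ_succ_pderiv hg 0),
    liftOne_of_pderiv_eq_zero (pderiv_succ_succ_pderiv hg 1), tupleDeriv_two_zero,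
    pderiv_pderiv_comm 0 1] at h1
  simp only [smul_eq_mul, nsmul_eq_mul, Nat.cast_ofNat, Nat.add_one_sub_one, pow_one] at h1
  linear_combination pderiv 0 (pderiv 0 g) * H.minors - pderiv 0 g * h1 + pderiv 0 g * hb

/-- The determinant relation says that the vertical field with coefficients g₂∂₁h - g₁∂₂h, evaluated
at (x₁,x₂,F), annihilates F; hence its divergence is zero. -/
theorem pairing_zero_two_eq :
    pderiv 1 g * pairing F (tupleDeriv 0 (tupleDeriv 2 h)) =
      pderiv 0 g * pairing F (tupleDeriv 1 (tupleDeriv 2 h)) := by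
  have hg := H.pderiv_snd
  have key := sum_eq_zero_of_vertical (F := F)
    (fun i => pderiv 1 g * evalAt F (tupleDeriv 0 h i) - pderiv 0 g * evalAt F (tupleDeriv 1 h i))
    (fun i => pderiv 1 g * evalAt F (tupleDeriv 2 (tupleDeriv 0 h) i) -
      pderiv 0 g * evalAt F (tupleDeriv 2 (tupleDeriv 1 h) i))
    (fun i j => by
      rw [map_sub, Derivation.map_mul_ring, Derivation.map_mul_ring, pderiv_succ_succ_evalAt,
        pderiv_succ_succ_evalAt, pderiv_succ_succ_pderiv hg, pderiv_succ_succ_pderiv hg]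
      ring)
  have hsum : ∀ v w : Fin m → MvPolynomial (Fin 3) K,
      ∑ i : Fin m, pderiv i.succ.succ F *
        (pderiv 1 g * evalAt F (v i) - pderiv 0 g * evalAt F (w i)) =
      pderiv 1 g * pairing F v - pderiv 0 g * pairing F w := by
    intro v w
    simp only [pairing, Finset.mul_sum, ← Finset.sum_sub_distrib]
    exact Finset.sum_congr rfl fun i _ => by ring
  rw [hsum, hsum, tupleDeriv_two_zero, tupleDeriv_two_one] at key
  linear_combination key (by linear_combination -H.det)

/-- The relation between the curvature numerator `κ` of the level curves of `g` and the
pairing `π` : `g₁ δκ = 3 κ (δg₁ + g₁ π)`, where `δ` is the Jacobian derivation of `g`. -/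
theorem jacobian_curvature {κ : MvPolynomial (Fin (m + 2)) K}
    (hκ : κ = pderiv 0 (pderiv 0 g) * pderiv 1 g ^ 2 -
      2 * pderiv 1 (pderiv 0 g) * pderiv 0 g * pderiv 1 g +
      pderiv 1 (pderiv 1 g) * pderiv 0 g ^ 2) :
    pderiv 0 g * liftJac F g h κ = 3 * κ * (pderiv 1 g * pderiv 0 (pderiv 0 g) -
      pderiv 0 g * pderiv 1 (pderiv 0 g) +
      pderiv 0 g * pairing F (tupleDeriv 0 (tupleDeriv 2 h))) := by
  have hg := H.pderiv_snd
  have g1 := fun k => pderiv_succ_succ_pderiv hg k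
  have g2 := fun k l => pderiv_succ_succ_pderiv (g1 k) l
  have hb := H.pairing_zero_two_eq
  have hk := H.curvature_eq hb
  rw [← hκ] at hk
  have ha := H.det
  -- `hc` and `hd` are the first and second derivatives of the determinant relation along the lift
  -- of ∂₁, the first simplified by `hb`. In the final combination `hd` cancels the third-order
  -- pairings in `hK`, which is δ applied to the formula for κ.
  have hc := congrArg (liftOne F h) ha
  rw [Derivation.map_mul_ring, Derivation.map_mul_ring, H.liftOne_pairing, H.liftOne_pairing,
    liftOne_of_pderiv_eq_zero (g1 0), liftOne_of_pderiv_eq_zero (g1 1), tupleDeriv_two_zero,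
    tupleDeriv_two_one] at hc
  replace hc : pderiv 0 g * pairing F (tupleDeriv 0 (tupleDeriv 1 h)) +
      pderiv 0 (pderiv 0 g) * pairing F (tupleDeriv 1 h) =
      pderiv 1 g * pairing F (tupleDeriv 0 (tupleDeriv 0 h)) +
      pderiv 0 (pderiv 1 g) * pairing F (tupleDeriv 0 h) := by
    linear_combination hc - pderiv 1 g * hb
  have he := congrArg (liftOne F h) hb
  have hu0 : pairing F (tupleDeriv 0 (tupleDeriv 2 (tupleDeriv 2 h))) = 0 :=
    H.pairing_tupleDeriv_zero H.pairing_two_two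
  have hd := congrArg (liftOne F h) hc
  have hu1 : pderiv 0 g * pairing F (tupleDeriv 1 (tupleDeriv 2 (tupleDeriv 2 h))) = 0 :=
    H.mul_pairing_tupleDeriv_one H.pairing_two_two
  simp only [map_add, Derivation.map_mul_ring, H.liftOne_pairing, liftOne_of_pderiv_eq_zero (g1 _),
    liftOne_of_pderiv_eq_zero (g2 _ _), tupleDeriv_two_zero, tupleDeriv_two_one, hu0] at hd he
  have h2 : liftJac F g h 2 = 0 := by simpa using (liftJac F g h).map_natCast 2
  have hK := congrArg (liftJac F g h) hk
  simp only [map_sub, Derivation.map_mul_ring, H.liftJac_pairing, liftJac_of_pderiv_eq_zero (g1 _),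
    liftJac_of_pderiv_eq_zero (g2 _ _), tupleDeriv_one_zero, h2, mul_zero,
    add_zero] at hK
  have hcomm : ∀ f : MvPolynomial (Fin (m + 2)) K,
      pderiv 0 (pderiv 1 f) = pderiv 1 (pderiv 0 f) := pderiv_pderiv_comm 0 1
  simp only [hcomm] at hc hd he hK
  generalize pairing F (tupleDeriv 0 (tupleDeriv 0 (tupleDeriv 0 h))) = Lxxx at *
  generalize pairing F (tupleDeriv 0 (tupleDeriv 0 (tupleDeriv 1 h))) = Lxxy at *
  generalize pairing F (tupleDeriv 0 (tupleDeriv 0 (tupleDeriv 2 h))) = Pxx at *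
  generalize pairing F (tupleDeriv 0 (tupleDeriv 1 (tupleDeriv 2 h))) = Pxy at *
  generalize pairing F (tupleDeriv 1 (tupleDeriv 2 (tupleDeriv 2 h))) = Pyt at *
  generalize pairing F (tupleDeriv 0 (tupleDeriv 0 h)) = Lxx at *
  generalize pairing F (tupleDeriv 0 (tupleDeriv 1 h)) = Lxy at *
  generalize pairing F (tupleDeriv 0 (tupleDeriv 2 h)) = Px at *
  generalize pairing F (tupleDeriv 1 (tupleDeriv 2 h)) = Py at *
  generalize pairing F (tupleDeriv 0 h) = Lx at *
  generalize pairing F (tupleDeriv 1 h) = Ly at *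
  generalize liftJac F g h κ = dκ at *
  subst hκ
  linear_combination pderiv 0 g * hK - pderiv 0 g ^ 2 * hd +
    3 * pderiv 0 g * pderiv 0 (pderiv 0 g) * hc +
    (pderiv 0 g * pderiv 0 (pderiv 0 (pderiv 0 g)) - 3 * pderiv 0 (pderiv 0 g) ^ 2) * ha +
    2 * pderiv 0 g * pderiv 0 (pderiv 0 g) * pderiv 1 g * hb -
    pderiv 0 g ^ 2 * pderiv 1 g * he + pderiv 0 g ^ 2 * pderiv 1 g ^ 2 * hu1 -
    (3 * (pderiv 1 g * pderiv 0 (pderiv 0 g) - pderiv 0 g * pderiv 1 (pderiv 0 g)) +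
      pderiv 0 g * Px) * hk

end NilpotencyEquations

end GeneralizedForm

/-! ### Vanishing of π and of L(∂₃h) -/

namespace GeneralizedForm

namespace NilpotencyEquations

variable {K : Type*} [Field K] [CharZero K] {m : ℕ} {F g : MvPolynomial (Fin (m + 2)) K}
  {h : Fin m → MvPolynomial (Fin 3) K} (H : NilpotencyEquations F g h)
include H

/-- The hypotheses say that δ annihilates g₁ and g₂, which makes δ locally nilpotent; so its
eigenvalue π vanishes. -/
theorem pairing_zero_two_eq_zero_of_lines
    (h0 : pderiv 1 g * pderiv 0 (pderiv 0 g) - pderiv 0 g * pderiv 1 (pderiv 0 g) = 0)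
    (h1 : pderiv 1 g * pderiv 0 (pderiv 1 g) - pderiv 0 g * pderiv 1 (pderiv 1 g) = 0) :
    pairing F (tupleDeriv 0 (tupleDeriv 2 h)) = 0 := by
  have hg := H.pderiv_snd
  have hm0 : pderiv 0 g ∈ (liftJac F g h).nilSubalgebra :=
    Derivation.mem_nilSubalgebra_of_map_eq_zero _
      (by rw [liftJac_of_pderiv_eq_zero (pderiv_succ_succ_pderiv hg 0), h0])
  have hm1 : pderiv 1 g ∈ (liftJac F g h).nilSubalgebra :=
    Derivation.mem_nilSubalgebra_of_map_eq_zero _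
      (by rw [liftJac_of_pderiv_eq_zero (pderiv_succ_succ_pderiv hg 1), h1])
  have hX0 : X 0 ∈ (liftJac F g h).nilSubalgebra := by
    refine Derivation.mem_nilSubalgebra_of_map _ ?_
    have : liftJac F g h (X 0) = pderiv 1 g := vectorField_X_zero _ _ _
    rwa [this]
  have hX1 : X 1 ∈ (liftJac F g h).nilSubalgebra := by
    refine Derivation.mem_nilSubalgebra_of_map _ ?_
    have : liftJac F g h (X 1) = -pderiv 0 g := vectorField_X_one _ _ _
    rw [this]
    exact neg_mem hm0
  have hF : F ∈ (liftJac F g h).nilSubalgebra :=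
    Derivation.mem_nilSubalgebra_of_map_eq_zero _ H.liftJac_fst
  have hnil : ∀ f, f ∈ (liftJac F g h).nilSubalgebra := by
    have hc : ∀ i, pderiv 1 g * evalAt F (pderiv 2 (h i)) - evalAt F (pderiv 0 (h i)) ∈
        (liftJac F g h).nilSubalgebra := fun i =>
      sub_mem (mul_mem hm1 (evalAt_mem_nilSubalgebra hX0 hX1 hF _))
        (evalAt_mem_nilSubalgebra hX0 hX1 hF _)
    rw [liftJac] at hc hm0 hm1 ⊢
    exact forall_mem_nilSubalgebra_vectorField _ _ _ hm1 (neg_mem hm0) hc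
  have h2 := mul_sum_eq_zero (fun j => (liftJac F g h).mul_eq_zero_of_map_eq_mul hnil
    (H.liftJac_pderiv_succ_succ j)) (fun i => evalAt F (tupleDeriv 0 (tupleDeriv 2 h) i))
  rw [← pairing] at h2
  exact mul_self_eq_zero.mp h2

/-- A Riccati equation: for u = π/g₁ it reads δu = πu. -/
theorem liftJac_pairing_zero_two :
    pderiv 0 g * liftJac F g h (pairing F (tupleDeriv 0 (tupleDeriv 2 h))) =
      pderiv 0 g * pairing F (tupleDeriv 0 (tupleDeriv 2 h)) ^ 2 +
        pairing F (tupleDeriv 0 (tupleDeriv 2 h)) *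
          (pderiv 1 g * pderiv 0 (pderiv 0 g) - pderiv 0 g * pderiv 1 (pderiv 0 g)) := by
  have hg := H.pderiv_snd
  have hb := H.pairing_zero_two_eq
  have he := congrArg (liftOne F h) hb
  have hu0 : pairing F (tupleDeriv 0 (tupleDeriv 2 (tupleDeriv 2 h))) = 0 :=
    H.pairing_tupleDeriv_zero H.pairing_two_two
  have hu1 : pderiv 0 g * pairing F (tupleDeriv 1 (tupleDeriv 2 (tupleDeriv 2 h))) = 0 :=
    H.mul_pairing_tupleDeriv_one H.pairing_two_two
  rw [Derivation.map_mul_ring, Derivation.map_mul_ring, H.liftOne_pairing, H.liftOne_pairing,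
    liftOne_of_pderiv_eq_zero (pderiv_succ_succ_pderiv hg _),
    liftOne_of_pderiv_eq_zero (pderiv_succ_succ_pderiv hg _), tupleDeriv_two_zero,
    tupleDeriv_two_one, hu0, pderiv_pderiv_comm 0 1] at he
  rw [H.liftJac_pairing, tupleDeriv_one_zero]
  linear_combination pderiv 0 g * he - pderiv 0 (pderiv 0 g) * hb - pderiv 0 g * pderiv 1 g * hu1

theorem pairing_zero_two_eq_zero_of_vertical (hgx : pderiv 0 g ≠ 0)
    (hπ : ∀ i : Fin m, pderiv i.succ.succ (pairing F (tupleDeriv 0 (tupleDeriv 2 h))) = 0) :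
    pairing F (tupleDeriv 0 (tupleDeriv 2 h)) = 0 := by
  have hg := H.pderiv_snd
  have hE := H.liftJac_pairing_zero_two
  rw [liftJac_of_pderiv_eq_zero hπ] at hE
  set π := pairing F (tupleDeriv 0 (tupleDeriv 2 h)) with hπdef
  by_contra hne
  -- On such tuples the pairing lies in K[x₁,x₂], so both lifts act on it as plane derivations.
  let good : (Fin m → MvPolynomial (Fin 3) K) → Prop := fun w =>
    (∀ i : Fin m, pderiv i.succ.succ (pairing F w) = 0) ∧ pairing F (tupleDeriv 2 w) = 0
  have good0 : ∀ w, good w → good (tupleDeriv 0 w) := by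
    rintro w ⟨h1, h2⟩
    have h3 := H.liftOne_pairing w
    rw [h2, liftOne_of_pderiv_eq_zero h1, mul_zero, sub_zero] at h3
    refine ⟨fun i => ?_, ?_⟩
    · rw [← h3, pderiv_succ_succ_pderiv h1]
    · rw [tupleDeriv_two_zero]
      exact H.pairing_tupleDeriv_zero h2
  have good1 : ∀ w, good w → good (tupleDeriv 1 w) := by
    intro w hw
    have h3 := H.liftJac_pairing w
    rw [liftJac_of_pderiv_eq_zero hw.1, ← hπdef] at h3
    refine ⟨fun i => ?_, ?_⟩
    · have h4 := congrArg (pderiv i.succ.succ) h3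
      simp only [map_add, map_sub, Derivation.map_mul_ring, hπ, hw.1, (good0 w hw).1,
        pderiv_succ_succ_pderiv hg, pderiv_succ_succ_pderiv hw.1] at h4
      refine (mul_eq_zero.mp ?_).resolve_left hgx
      linear_combination h4
    · rw [tupleDeriv_two_one]
      exact H.pairing_tupleDeriv_one hgx hw.2
  have good_iter : ∀ (k : Fin 3), (∀ w, good w → good (tupleDeriv k w)) → ∀ w, good w →
      pairing F w ≠ 0 → ∃ n, good ((tupleDeriv k)^[n] w) ∧ pairing F ((tupleDeriv k)^[n] w) ≠ 0 ∧
        pairing F (tupleDeriv k ((tupleDeriv k)^[n] w)) = 0 := by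
    intro k hk w hw hw0
    have hiter : ∀ n i, (tupleDeriv k)^[n] w i = (pderiv k)^[n] (w i) := by
      intro n i
      induction n with
      | zero => rw [Function.iterate_zero, Function.iterate_zero, id, id]
      | succ n ih => rw [Function.iterate_succ_apply', Function.iterate_succ_apply', ← ih]
    have hgood : ∀ n, good ((tupleDeriv k)^[n] w) := by
      intro n
      induction n with
      | zero => exact hw
      | succ n ih => rw [Function.iterate_succ_apply']; exact hk _ ih
    choose n hn using fun i => mem_nilSubalgebra_pderiv k (w i)
    obtain ⟨M, hM⟩ := (Set.finite_range n).bddAbove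
    have hex : ∃ N, pairing F ((tupleDeriv k)^[N] w) = 0 := by
      refine ⟨M, Finset.sum_eq_zero fun i _ => ?_⟩
      rw [hiter, (pderiv k).iterate_eq_zero_of_le (hn i) (hM ⟨i, rfl⟩), map_zero, mul_zero]
    classical
    have hpos : Nat.find hex ≠ 0 := fun h0 => hw0 ((Nat.find_eq_zero hex).mp h0)
    refine ⟨Nat.find hex - 1, hgood _, Nat.find_min hex (by omega), ?_⟩
    rw [← Function.iterate_succ_apply' (tupleDeriv k), Nat.succ_eq_add_one,
      Nat.sub_add_cancel (Nat.one_le_iff_ne_zero.mpr hpos)]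
    exact Nat.find_spec hex
  have hgoodπ : good (tupleDeriv 0 (tupleDeriv 2 h)) := by
    refine ⟨hπ, ?_⟩
    rw [tupleDeriv_two_zero]
    exact H.pairing_tupleDeriv_zero H.pairing_two_two
  -- Differentiate as often as possible in x₁ and then in x₂ while the pairing stays nonzero; for
  -- the resulting l this leaves ∂l/∂x₁ = 0 and δl = πl.
  obtain ⟨n, hw1, hw1ne, hw1x⟩ := good_iter 0 good0 _ hgoodπ hne
  set w1 := (tupleDeriv 0)^[n] (tupleDeriv 0 (tupleDeriv 2 h))
  obtain ⟨k, hw2, hw2ne, hw2y⟩ := good_iter 1 good1 _ hw1 hw1ne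
  have hw2x : pairing F (tupleDeriv 0 ((tupleDeriv 1)^[k] w1)) = 0 := by
    have h1 : ∀ k, tupleDeriv 0 ((tupleDeriv 1)^[k] w1) = (tupleDeriv 1)^[k] (tupleDeriv 0 w1) := by
      intro k
      induction k with
      | zero => rfl
      | succ k ih =>
        rw [Function.iterate_succ_apply', Function.iterate_succ_apply', tupleDeriv_comm, ih]
    rw [h1]
    clear * - hw1x H hgx
    induction k with
    | zero => exact hw1x
    | succ k ih => rw [Function.iterate_succ_apply']; exact H.pairing_tupleDeriv_one hgx ih
  set w2 := (tupleDeriv 1)^[k] w1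
  set l := pairing F w2 with hl
  have hlx : pderiv 0 l = 0 := by
    have h1 := H.liftOne_pairing w2
    rwa [← hl, liftOne_of_pderiv_eq_zero hw2.1, hw2.2, hw2x, mul_zero, sub_zero] at h1
  have hly : -(pderiv 0 g * pderiv 1 l) = π * l := by
    have h1 := H.liftJac_pairing w2
    rw [← hl, liftJac_of_pderiv_eq_zero hw2.1, hw2y, hw2x, hlx, ← hπdef] at h1
    linear_combination h1
  have hlyx : pderiv 0 (pderiv 1 l) = 0 := by rw [pderiv_pderiv_comm, hlx, map_zero]
  have h1 := congrArg (pderiv 0) hly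
  have h2 := congrArg (pderiv 1) hly
  simp only [map_neg, Derivation.map_mul_ring, hlx, hlyx] at h1 h2
  -- Substituting π = -g₁l'/l, with l' = ∂l/∂x₂, into the Riccati equation leaves (1/l)'' = 0.
  have hl2 : l * pderiv 1 (pderiv 1 l) = 2 * pderiv 1 l ^ 2 := by
    have h3 : pderiv 0 g ^ 3 * (l * pderiv 1 (pderiv 1 l) - 2 * pderiv 1 l ^ 2) = 0 := by
      linear_combination -(pderiv 0 g ^ 2 * l) * h2 + l ^ 2 * hE + pderiv 0 g * pderiv 1 g * l * h1 -
        (l * (pderiv 1 g * pderiv 0 (pderiv 0 g) - pderiv 0 g * pderiv 1 (pderiv 0 g)) +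
          pderiv 0 g * (l * π - 2 * pderiv 0 g * pderiv 1 l)) * hly
    exact sub_eq_zero.mp ((mul_eq_zero.mp h3).resolve_left (pow_ne_zero 3 hgx))
  have hl1 := (pderiv 1).map_eq_zero_of_mul_map_map (mem_nilSubalgebra_pderiv 1) hl2
  rw [hl1, mul_zero, neg_zero] at hly
  exact (mul_ne_zero hne hw2ne) hly.symm

/-- If `∂g/∂x₁ ≠ 0`, then the `x₁`-derivative of the tuple `∂h/∂x₃` lies in the kernel of the
pairing. -/
theorem pairing_zero_two_eq_zero (hgx : pderiv 0 g ≠ 0) :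
    pairing F (tupleDeriv 0 (tupleDeriv 2 h)) = 0 := by
  have hg := H.pderiv_snd
  have g1 := fun k => pderiv_succ_succ_pderiv hg k
  have g2 := fun k l => pderiv_succ_succ_pderiv (g1 k) l
  set κ := pderiv 0 (pderiv 0 g) * pderiv 1 g ^ 2 -
      2 * pderiv 1 (pderiv 0 g) * pderiv 0 g * pderiv 1 g +
      pderiv 1 (pderiv 1 g) * pderiv 0 g ^ 2 with hκ
  by_cases hκ0 : κ = 0
  · obtain ⟨h0, h1⟩ := jacobian_pderiv_eq_zero hgx hκ0
    exact H.pairing_zero_two_eq_zero_of_lines h0 h1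
  refine H.pairing_zero_two_eq_zero_of_vertical hgx fun i => ?_
  have hκi : ∀ i : Fin m, pderiv i.succ.succ κ = 0 := by
    intro i
    have h2 : pderiv i.succ.succ (2 : MvPolynomial (Fin (m + 2)) K) = 0 := by
      simpa using (pderiv (R := K) i.succ.succ).map_natCast 2
    simp [hκ, Derivation.leibniz_pow, g1, g2, h2]
  -- In the curvature identity all terms except π are free of x₃,…,xₙ, and π has the nonzero
  -- coefficient 3κg₁.
  have key := congrArg (pderiv i.succ.succ) (H.jacobian_curvature hκ)
  have h3 : pderiv i.succ.succ (3 : MvPolynomial (Fin (m + 2)) K) = 0 := by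
    simpa using (pderiv (R := K) i.succ.succ).map_natCast 3
  rw [liftJac_of_pderiv_eq_zero hκi] at key
  simp only [Derivation.map_mul_ring, map_add, map_sub, g1, g2, hκi, h3,
    pderiv_succ_succ_pderiv hκi] at key
  have h4 : 3 * κ * pderiv 0 g *
      pderiv i.succ.succ (pairing F (tupleDeriv 0 (tupleDeriv 2 h))) = 0 := by
    linear_combination -key
  exact (mul_eq_zero.mp h4).resolve_left
    (mul_ne_zero (mul_ne_zero (by exact_mod_cast Nat.succ_ne_zero 2) hκ0) hgx)

/-- The conclusion when `g` is constant. -/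
theorem pairing_two_eq_zero_of_fst (hℓ : pairing F (tupleDeriv 0 h) = 0)
    (hh : ∀ i, h i ∈ Ideal.span {X 0, X 2 ^ 2}) : pairing F (tupleDeriv 2 h) = 0 := by
  have hπ : pairing F (tupleDeriv 0 (tupleDeriv 2 h)) = 0 := by
    rw [← tupleDeriv_two_zero]
    exact pairing_tupleDeriv_two hℓ
  have h1 := pairing_sub_substZero_two H.pairing_two_two
  have h2 := H.pairing_sub_substZero_zero (w := fun i => substZero 2 (tupleDeriv 2 h i)) (by
    have h3 := (pairingKer F).sub_mem (x := tupleDeriv 0 (tupleDeriv 2 h)) hπ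
      (H.pairing_tupleDeriv_zero h1)
    convert mem_pairingKer.mp h3 using 2
    ext1 i
    simp [tupleDeriv])
  have h3 := (pairingKer F).add_mem (x := _) h1 h2
  convert mem_pairingKer.mp h3 using 2
  ext1 i
  -- The square on x₃ in the ideal is what makes the x₃-derivative vanish at x₁ = x₃ = 0.
  have h4 : substZero 0 (substZero 2 (pderiv 2 (h i))) = 0 := by
    obtain ⟨a, b, hab⟩ := Ideal.mem_span_pair.mp (hh i)
    rw [← hab]
    simp [Derivation.leibniz_pow, substZero_X_self, substZero_X_of_ne]
  simp [tupleDeriv, h4]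

/-- The conclusion when `∂g/∂x₁ ≠ 0`. -/
theorem pairing_two_eq_zero (hgx : pderiv 0 g ≠ 0)
    (hh : ∀ i, h i ∈ Ideal.span {X 0, X 1, X 2 ^ 2}) : pairing F (tupleDeriv 2 h) = 0 := by
  have hπ := H.pairing_zero_two_eq_zero hgx
  have hπ' : pairing F (tupleDeriv 1 (tupleDeriv 2 h)) = 0 := by
    have h1 := H.pairing_zero_two_eq
    rw [hπ, mul_zero] at h1
    exact (mul_eq_zero.mp h1.symm).resolve_left hgx
  have h1 := pairing_sub_substZero_two H.pairing_two_two
  have h2 := H.pairing_sub_substZero_zero (w := fun i => substZero 2 (tupleDeriv 2 h i)) (by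
    have h3 := (pairingKer F).sub_mem (x := tupleDeriv 0 (tupleDeriv 2 h)) hπ
      (H.pairing_tupleDeriv_zero h1)
    convert mem_pairingKer.mp h3 using 2
    ext1 i
    simp [tupleDeriv])
  have h3 := (pairingKer F).add_mem (x := _) h1 h2
  have h4 := H.pairing_sub_substZero_one hgx
    (w := fun i => substZero 0 (substZero 2 (tupleDeriv 2 h i))) (by
    have h5 := (pairingKer F).sub_mem (x := tupleDeriv 1 (tupleDeriv 2 h)) hπ'
      (H.pairing_tupleDeriv_one hgx (mem_pairingKer.mp h3))
    convert mem_pairingKer.mp h5 using 2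
    ext1 i
    simp [tupleDeriv])
  have h5 := (pairingKer F).add_mem (x := _) h3 h4
  convert mem_pairingKer.mp h5 using 2
  ext1 i
  have h6 : substZero 1 (substZero 0 (substZero 2 (pderiv 2 (h i)))) = 0 := by
    obtain ⟨a, q, hq, hab⟩ := Ideal.mem_span_insert.mp (hh i)
    obtain ⟨b, c, rfl⟩ := Ideal.mem_span_pair.mp hq
    rw [hab]
    simp [Derivation.leibniz_pow, substZero_X_self, substZero_X_of_ne]
  simp [tupleDeriv, h6]

end NilpotencyEquations

end GeneralizedForm

/-! ### Reduction to a 3×3 matrix and conclusion -/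

theorem Matrix.isNilpotent_mul_comm_of_isNilpotent {ι κ R : Type*} [Fintype ι] [Fintype κ]
    [DecidableEq ι] [DecidableEq κ] [CommRing R] {A : Matrix ι κ R} {B : Matrix κ ι R}
    (h : IsNilpotent (A * B)) : IsNilpotent (B * A) := by
  obtain ⟨n, hn⟩ := h
  have key : ∀ n : ℕ, (B * A) ^ (n + 1) = B * (A * B) ^ n * A := by
    intro n
    induction n with
    | zero => simp
    | succ n ih =>
      rw [pow_succ, ih, pow_succ (A * B)]
      simp only [Matrix.mul_assoc]
  exact ⟨n + 1, by rw [key, hn, Matrix.mul_zero, Matrix.zero_mul]⟩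

namespace GeneralizedForm

variable {K : Type*} [Field K] {m : ℕ}

/-- The left factor of the factorization of the Jacobian matrix through a module of rank three. -/
noncomputable def leftFactor (F g : MvPolynomial (Fin (m + 2)) K)
    (h : Fin m → MvPolynomial (Fin 3) K) :
    Matrix (Fin (m + 2)) (Fin 3) (MvPolynomial (Fin (m + 2)) K) :=
  Matrix.of (Fin.cons ![0, 0, 1] (Fin.cons ![pderiv 0 g, pderiv 1 g, 0]
    fun i k => evalAt F (pderiv k (h i))))

theorem leftFactor_mul {H : Fin (m + 2) → MvPolynomial (Fin (m + 2)) K}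
    {h : Fin m → MvPolynomial (Fin 3) K} (hg : ∀ i : Fin m, pderiv i.succ.succ (H 1) = 0)
    (hH : ∀ i : Fin m, H i.succ.succ = evalAt (H 0) (h i)) :
    leftFactor (H 0) (H 1) h * Matrix.of (fun k j => pderiv j (![X 0, X 1, H 0] k)) =
      polyJacobian H := by
  ext1 i j
  rw [Matrix.mul_apply, Fin.sum_univ_three]
  refine Fin.cases ?_ (fun i => Fin.cases ?_ (fun i => ?_) i) i
  · simp [leftFactor, polyJacobian]
  · have h1 : pderiv j (H 1) = pderiv 0 (H 1) * pderiv j (X 0) + pderiv 1 (H 1) * pderiv j (X 1) := by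
      refine Fin.cases ?_ (fun j => Fin.cases ?_ (fun j => ?_) j) j
      · simp
      · simp
      · rw [hg, pderiv_X_of_ne (Fin.succ_ne_zero _).symm, pderiv_X_of_ne (one_ne_succ_succ j)]
        simp
    simp [leftFactor, polyJacobian, h1]
  · have h1 : polyJacobian H i.succ.succ j = pderiv j (evalAt (H 0) (h i)) := by
      rw [← hH]
      rfl
    rw [h1, derivation_evalAt]
    simp [leftFactor]

theorem mul_leftFactor_apply (F g : MvPolynomial (Fin (m + 2)) K)
    (h : Fin m → MvPolynomial (Fin 3) K) (k l : Fin 3) :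
    (Matrix.of (fun k j => pderiv j (![X 0, X 1, F] k)) * leftFactor F g h) k l =
      vectorField (![0, 0, 1] l) (![pderiv 0 g, pderiv 1 g, 0] l)
        (fun i => evalAt F (pderiv l (h i))) (![X 0, X 1, F] k) := by
  rw [Matrix.mul_apply, Fin.sum_univ_succ, Fin.sum_univ_succ, vectorField_apply]
  have h1 : ∑ i : Fin m, evalAt F (pderiv l (h i)) * pderiv i.succ.succ (![X 0, X 1, F] k) =
      ∑ i : Fin m, pderiv i.succ.succ (![X 0, X 1, F] k) * evalAt F (pderiv l (h i)) :=
    Finset.sum_congr rfl fun i _ => mul_comm _ _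
  rw [h1, mul_comm (![0, 0, 1] l), mul_comm (![pderiv 0 g, pderiv 1 g, 0] l)]
  exact (add_assoc _ _ _).symm

theorem nilpotencyEquations_of_isNilpotent [CharZero K]
    {H : Fin (m + 2) → MvPolynomial (Fin (m + 2)) K} {h : Fin m → MvPolynomial (Fin 3) K}
    (hg : ∀ i : Fin m, pderiv i.succ.succ (H 1) = 0)
    (hH : ∀ i : Fin m, H i.succ.succ = evalAt (H 0) (h i)) (hnil : IsNilpotent (polyJacobian H)) :
    NilpotencyEquations (H 0) (H 1) h := by
  rw [← leftFactor_mul hg hH] at hnil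
  replace hnil := Matrix.isNilpotent_mul_comm_of_isNilpotent hnil
  have hM := mul_leftFactor_apply (H 0) (H 1) h
  set M := Matrix.of (fun k j => pderiv j (![X 0, X 1, H 0] k)) * leftFactor (H 0) (H 1) h
  have hp : ∀ (a b : MvPolynomial (Fin (m + 2)) K) (k : Fin 3),
      vectorField a b (fun i => evalAt (H 0) (pderiv k (h i))) (H 0) =
        a * pderiv 0 (H 0) + b * pderiv 1 (H 0) + pairing (H 0) (tupleDeriv k h) := by
    intro a b k
    rw [vectorField_apply, pairing]
    exact congrArg _ (Finset.sum_congr rfl fun i _ => mul_comm _ _)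
  have h00 : M 0 0 = 0 := by rw [hM]; exact vectorField_X_zero _ _ _
  have h01 : M 0 1 = 0 := by rw [hM]; exact vectorField_X_zero _ _ _
  have h02 : M 0 2 = 1 := by rw [hM]; exact vectorField_X_zero _ _ _
  have h10 : M 1 0 = pderiv 0 (H 1) := by rw [hM]; exact vectorField_X_one _ _ _
  have h11 : M 1 1 = pderiv 1 (H 1) := by rw [hM]; exact vectorField_X_one _ _ _
  have h12 : M 1 2 = 0 := by rw [hM]; exact vectorField_X_one _ _ _
  have h20 := (hM 2 0).trans (hp _ _ _)
  have h21 := (hM 2 1).trans (hp _ _ _)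
  have h22 := (hM 2 2).trans (hp _ _ _)
  have htr := (Matrix.isNilpotent_trace_of_isNilpotent hnil).eq_zero
  have htr2 := (Matrix.isNilpotent_trace_of_isNilpotent (hnil.pow_of_pos two_ne_zero)).eq_zero
  have hdet : M.det = 0 := by
    obtain ⟨n, hn⟩ := hnil
    have : M.det ^ n = 0 := by
      rw [← Matrix.det_pow, hn, Matrix.det_zero]
    exact eq_zero_of_pow_eq_zero this
  rw [Matrix.trace_fin_three, h00, h11, h22] at htr
  rw [pow_two, Matrix.trace_fin_three, Matrix.mul_apply, Matrix.mul_apply, Matrix.mul_apply,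
    Fin.sum_univ_three, Fin.sum_univ_three, Fin.sum_univ_three, h00, h01, h02, h10, h11, h12, h20,
    h21, h22] at htr2
  rw [Matrix.det_fin_three, h00, h01, h02, h10, h11, h12, h20, h21, h22] at hdet
  simp only [Matrix.cons_val] at htr htr2 hdet
  have hminors : pderiv 0 (H 1) * pderiv 1 (H 0) + pairing (H 0) (tupleDeriv 0 h) =
      -pderiv 1 (H 1) ^ 2 := by
    -- With M₂₂ = c, the combination tr M² - (c - g₂) tr M equals 2(M₂₀ + g₂²).
    refine mul_left_cancel₀ (two_ne_zero (α := MvPolynomial (Fin (m + 2)) K)) ?_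
    linear_combination htr2 - (pderiv 0 (H 0) + pairing (H 0) (tupleDeriv 2 h) -
      pderiv 1 (H 1)) * htr
  refine ⟨hg, ?_, hminors, ?_⟩
  · linear_combination htr
  · linear_combination hdet

end GeneralizedForm

theorem pderiv_succ_succ_eq_zero_of_mem_adjoin {K : Type*} [Field K] {m : ℕ}
    {f : MvPolynomial (Fin (m + 2)) K}
    (hf : f ∈ Algebra.adjoin K {MvPolynomial.X 0, MvPolynomial.X 1}) (i : Fin m) :
    pderiv i.succ.succ f = 0 := by
  have h2 : Set.EqOn (pderiv (R := K) i.succ.succ) (0 : Derivation K _ _)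
      {(X 0 : MvPolynomial (Fin (m + 2)) K), X 1} := by
    rintro _ (rfl | rfl)
    · exact pderiv_X_of_ne (Fin.succ_ne_zero _).symm
    · exact pderiv_X_of_ne (GeneralizedForm.one_ne_succ_succ i)
  exact Derivation.eqOn_adjoin h2 hf

theorem mainTheorem6 {K : Type*} [Field K] [CharZero K] {m : ℕ}
    (H : Fin (m + 2) → MvPolynomial (Fin (m + 2)) K)
    (h : Fin m → MvPolynomial (Fin 3) K)
    (hform : HasGeneralizedForm H h)
    (hnil : IsNilpotent (polyJacobian H)) :
    (((∃ c : K, H 1 = MvPolynomial.C c) ∧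
        (∀ i : Fin m, h i ∈ Ideal.span {MvPolynomial.X 0, MvPolynomial.X 2 ^ 2})) →
      MvPolynomial.pderiv 0 (H 0) + MvPolynomial.pderiv 1 (H 1) = 0) ∧
    ((¬ (∃ c : K, H 1 = MvPolynomial.C c) ∧
        (∀ i : Fin m, h i ∈
          Ideal.span {MvPolynomial.X 0, MvPolynomial.X 1, MvPolynomial.X 2 ^ 2})) →
      MvPolynomial.pderiv 0 (H 0) + MvPolynomial.pderiv 1 (H 1) = 0) := by
  have hg := pderiv_succ_succ_eq_zero_of_mem_adjoin hform.second_mem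
  have E := GeneralizedForm.nilpotencyEquations_of_isNilpotent hg hform.rest_eq hnil
  have goal : GeneralizedForm.pairing (H 0) (GeneralizedForm.tupleDeriv 2 h) = 0 →
      pderiv 0 (H 0) + pderiv 1 (H 1) = 0 := fun h0 => by
    linear_combination E.trace - h0
  refine ⟨fun ⟨⟨c, hc⟩, hh⟩ => goal (E.pairing_two_eq_zero_of_fst ?_ hh),
    fun ⟨hc, hh⟩ => goal (E.pairing_two_eq_zero (fun h0 => hc ?_) hh)⟩
  · have h1 := E.minors
    rw [hc, pderiv_C, pderiv_C] at h1
    linear_combination h1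
  · have h1 := E.minors
    have h2 := E.det
    -- If g₁ = 0, then L(∂₁h) = -g₂² and g₂L(∂₁h) = 0, so g₂³ = 0 and g would be constant.
    have h3 : pderiv 1 (H 1) = 0 := by
      rw [h0] at h1 h2
      refine pow_eq_zero_iff (n := 3) (by omega) |>.mp ?_
      linear_combination h2 + pderiv 1 (H 1) * h1
    refine exists_eq_C_of_pderiv_eq_zero fun i => ?_
    refine Fin.cases h0 (fun i => Fin.cases ?_ (fun i => ?_) i) i
    exacts [h3, hg i]
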